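/- For $n\ge 5$ let $Q_n=\{1,\dots,n\}$, $\Sigma=\{a,b,c,d,e,f\}$, and let $\mathcal D_n=(Q_n,\Sigma,\delta_n,1,\{n\})$ be the deterministic finite automaton with initial state $1$, unique final state $n$, whose letters induce the following transformations of $Q_n$ (states not mentioned are fixed): $a$ is the cycle $(2,3,\dots,n-1)$; $b$ is the transposition $(2,3)$; $c$ maps $n-1$ to $2$; $d$ maps $n-1$ to $1$; $e$ maps every state of $\{1,\dots,n-1\}$ to $2$; $f$ maps $2$ to $n$. Let $L_n\subseteq\Sigma^*$ be the language accepted by $\mathcal D_n$. Over the five-letter alphabet $\Gamma=\{a,b,d,e,f\}$, let $L_n(a,b,-,d,e,f)=L_n\cap\Gamma^*$, and let $L_n(b,a,-,d,e,f)\subseteq\Gamma^*$ be the language obtained from $L_n\cap\Gamma^*$ by interchanging the letters $a$ and $b$ in every word. The complexity of a language $L\subseteq\Gamma^*$ is the number of distinct left quotients $w^{-1}L=\{x\in\Gamma^*\mid wx\in L\}$, $w\in\Gamma^*$ (equivalently, for regular $L$, the number of states of a minimal deterministic finite automaton over $\Gamma$ accepting $L$). **Theorem (Two-Sided Ideals: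 Boolean Operations).** Let $m,n\ge 5$. 1. The complexity of $L_m(a,b,-,d,e,f)\cap L_n(b,a,-,d,e,f)$ is $mn$. 2. The complexity of the symmetric difference $L_m(a,b,-,d,e,f)\oplus L_n(b,a,-,d,e,f)$ is $mn$. 3. The complexity of $L_m(a,b,-,d,e,f)\setminus L_n(b,a,-,d,e,f)$ is $mn-(m-1)$. 4. The complexity of $L_m(a,b,-,d,e,f)\cup L_n(b,a,-,d,e,f)$ is $mn-(m+n-2)$. -/

import Mathlib

namespace TwoSidedIdeals

/-- The six-letter ordered alphabet `Σ = {a, b, c, d, e, f}`. -/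
inductive Letter
  | a | b | c | d | e | f
  deriving DecidableEq

/-- The quotient complexity (equivalently, state complexity) of a language over the alphabet `α`:
the number of its left quotients `w⁻¹L = {x | wx ∈ L}`, `w` ranging over all words over `α`.
(`Set.ncard` is `0` on infinite sets; as `L` is always among its own quotients, a positive value
means exactly that the set of quotients is finite with that many elements.) -/
noncomputable def complexity {α : Type*} (L : Language α) : ℕ :=
  (Set.range L.leftQuotient).ncard

/-- The image of a language under the substitution `s_π` of a partial map `π` of letters:
a letter `x` goes to `{π x}` where `π x` is defined, and to `∅` where it is undefined (`none`).
So the words of `L` that contain a letter with undefined image contribute nothing. -/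
def dialect {α β : Type*} (π : α → Option β) (L : Language α) : Language β :=
  {w | ∃ v ∈ L, v.map π = w.map some}

/-- The set of states `Q_n = {1, 2, …, n}`. -/
abbrev State (n : ℕ) : Type := {q : ℕ // 1 ≤ q ∧ q ≤ n}

/-- The transformations of `Q_n` induced by the letters. -/
def act (n : ℕ) : Letter → ℕ → ℕ
  -- the cycle `(2, 3, …, n-1)`
  | .a, q => if 2 ≤ q ∧ q + 1 < n then q + 1 else if q + 1 = n then 2 else q
  -- the transposition `(2, 3)`
  | .b, q => if q = 2 then 3 else if q = 3 then 2 else q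
  -- `(n-1 → 2)`
  | .c, q => if q + 1 = n then 2 else q
  -- `(n-1 → 1)`
  | .d, q => if q + 1 = n then 1 else q
  -- `(Q_{n-1} → 2)`
  | .e, q => if q < n then 2 else q
  -- `(2 → n)`
  | .f, q => if q = 2 then n else q

theorem act_mem {n : ℕ} (hn : 5 ≤ n) (x : Letter) (q : ℕ) (hq : 1 ≤ q ∧ q ≤ n) :
    1 ≤ act n x q ∧ act n x q ≤ n := by
  cases x <;> simp only [act] <;> split_ifs <;> omega

/-- The automaton `D_n(a,b,c,d,e,f) = (Q_n, Σ, δ, 1, {n})`, `n ≥ 5`. -/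
def witnessDFA (n : ℕ) (hn : 5 ≤ n) : DFA Letter (State n) where
  step q x := ⟨act n x q.1, act_mem hn x q.1 q.2⟩
  start := ⟨1, by omega⟩
  accept := {q | q.1 = n}

/-- The language `L_n(a,b,c,d,e,f)`. -/
def witness (n : ℕ) (hn : 5 ≤ n) : Language Letter :=
  (witnessDFA n hn).accepts

/-- The five-letter alphabet `{a, b, d, e, f} = Σ \ {c}` over which the dialects below live. -/
abbrev SubLetter : Type := {x : Letter // x ≠ Letter.c}

/-- The partial permutation `(a, b, c, d, e, f) ↦ (a, b, -, d, e, f)`. -/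
def permAB : Letter → Option SubLetter
  | .a => some ⟨.a, by decide⟩
  | .b => some ⟨.b, by decide⟩
  | .c => none
  | .d => some ⟨.d, by decide⟩
  | .e => some ⟨.e, by decide⟩
  | .f => some ⟨.f, by decide⟩

/-- The partial permutation `(a, b, c, d, e, f) ↦ (b, a, -, d, e, f)`. -/
def permBA : Letter → Option SubLetter
  | .a => some ⟨.b, by decide⟩
  | .b => some ⟨.a, by decide⟩
  | .c => none
  | .d => some ⟨.d, by decide⟩
  | .e => some ⟨.e, by decide⟩
  | .f => some ⟨.f, by decide⟩

/-- The dialect `L_n(a,b,-,d,e,f)`, a language over `{a, b, d, e, f}`. -/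
def witnessAB (n : ℕ) (hn : 5 ≤ n) : Language SubLetter :=
  dialect permAB (witness n hn)

/-- The dialect `L_n(b,a,-,d,e,f)`, a language over `{a, b, d, e, f}`. -/
def witnessBA (n : ℕ) (hn : 5 ≤ n) : Language SubLetter :=
  dialect permBA (witness n hn)

end TwoSidedIdeals

namespace TwoSidedIdeals

/-! Both dialects are recognised by the direct product of the two automata, the second reading each
word with `a` and `b` interchanged. Quotients of a boolean combination are the futures of the
reachable product states, so each complexity is a count of distinct futures.

All `mn` states are reachable (`reach_from_start`): `e` collapses to `(2, 2)`, and `a` and `b` each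
rotate one coordinate while only transposing 2 and 3 in the other, which allows nearly independent
control; `d` supplies state 1 and `f` the final states.

For separation, `exists_word_fst` turns distinct nonfinal first coordinates into one final and one
nonfinal, and `exists_word_final_right` then leads to `(m, n)` against `(1, n)`. If acceptance
distinguishes these two, and also `(m, 1)` from `(m, n)`, all `mn` futures differ: this covers
intersection and symmetric difference. For difference the `m` states `(p, n)` share the empty
future; for union the `m + n - 1` states with a final coordinate share the full one. Nothing else
merges. -/

/-- Interchange of the letters `a` and `b`. -/
def swapLetter : SubLetter → SubLetter
  | ⟨.a, _⟩ => ⟨.b, by decide⟩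
  | ⟨.b, _⟩ => ⟨.a, by decide⟩
  | x => x

/-- One step of the direct product of the automata of the two dialects. -/
def step (m n : ℕ) (s : ℕ × ℕ) (x : SubLetter) : ℕ × ℕ :=
  (act m x.1 s.1, act n (swapLetter x).1 s.2)

/-- The state of the product automaton after reading a word from the state `s`. -/
def run (m n : ℕ) (s : ℕ × ℕ) (w : List SubLetter) : ℕ × ℕ :=
  w.foldl (step m n) s

/-- Reachability in the product automaton. -/
def Reach (m n : ℕ) (s t : ℕ × ℕ) : Prop := ∃ w, run m n s w = t

abbrev la : SubLetter := ⟨.a, by decide⟩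
abbrev lb : SubLetter := ⟨.b, by decide⟩
abbrev ld : SubLetter := ⟨.d, by decide⟩
abbrev le : SubLetter := ⟨.e, by decide⟩
abbrev lf : SubLetter := ⟨.f, by decide⟩

theorem swapLetter_swapLetter (x : SubLetter) : swapLetter (swapLetter x) = x := by
  obtain ⟨x, hx⟩ := x
  cases x <;> rfl

/-! ### Runs of the product automaton and its left-right symmetry. -/

section Runs

variable {m n : ℕ}

theorem run_append (s : ℕ × ℕ) (v w : List SubLetter) :
    run m n s (v ++ w) = run m n (run m n s v) w :=
  List.foldl_append

theorem run_cons (s : ℕ × ℕ) (x : SubLetter) (w : List SubLetter) :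
    run m n s (x :: w) = run m n (step m n s x) w := rfl

theorem run_nil (s : ℕ × ℕ) : run m n s [] = s := rfl

theorem run_swap (s : ℕ × ℕ) (w : List SubLetter) :
    run n m s.swap (w.map swapLetter) = (run m n s w).swap := by
  induction w generalizing s with
  | nil => rfl
  | cons x w ih =>
    rw [List.map_cons, run_cons, run_cons, ← ih]
    simp [step, swapLetter_swapLetter]

theorem run_fst (s : ℕ × ℕ) (w : List SubLetter) :
    (run m n s w).1 = (w.map Subtype.val).foldl (fun p x => act m x p) s.1 := by
  induction w generalizing s with
  | nil => rfl
  | cons x w ih => rw [run_cons, ih]; rfl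

theorem run_snd (s : ℕ × ℕ) (w : List SubLetter) :
    (run m n s w).2 =
      (w.map fun x => (swapLetter x).1).foldl (fun p x => act n x p) s.2 := by
  induction w generalizing s with
  | nil => rfl
  | cons x w ih => rw [run_cons, ih]; rfl

theorem run_fst_congr {s t : ℕ × ℕ} (h : s.1 = t.1) (w : List SubLetter) :
    (run m n s w).1 = (run m n t w).1 := by
  rw [run_fst, run_fst, h]

theorem run_snd_congr {s t : ℕ × ℕ} (h : s.2 = t.2) (w : List SubLetter) :
    (run m n s w).2 = (run m n t w).2 := by
  rw [run_snd, run_snd, h]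

theorem run_replicate (s : ℕ × ℕ) (x : SubLetter) (k : ℕ) :
    run m n s (List.replicate k x) = ((act m x.1)^[k] s.1, (act n (swapLetter x).1)^[k] s.2) := by
  induction k generalizing s with
  | zero => rfl
  | succ k ih => rw [List.replicate_succ, run_cons, ih]; rfl

theorem act_final (hn : 5 ≤ n) (x : Letter) : act n x n = n := by
  cases x <;> simp only [act] <;> split_ifs <;> omega

theorem run_fst_final (hm : 5 ≤ m) (q : ℕ) (w : List SubLetter) : (run m n (m, q) w).1 = m := by
  induction w generalizing q with
  | nil => rfl
  | cons x w ih => rw [run_cons, step, act_final hm]; exact ih _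

theorem run_snd_final (hn : 5 ≤ n) (p : ℕ) (w : List SubLetter) : (run m n (p, n) w).2 = n := by
  induction w generalizing p with
  | nil => rfl
  | cons x w ih => rw [run_cons, step, act_final hn]; exact ih _

theorem Reach.refl (s : ℕ × ℕ) : Reach m n s s := ⟨[], rfl⟩

theorem Reach.trans {s t u : ℕ × ℕ} (h : Reach m n s t) (h' : Reach m n t u) : Reach m n s u := by
  obtain ⟨v, rfl⟩ := h
  obtain ⟨w, rfl⟩ := h'
  exact ⟨v ++ w, run_append s v w⟩

theorem Reach.letter {s t u : ℕ × ℕ} (h : Reach m n s t) (x : SubLetter)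
    (hx : step m n t x = u) : Reach m n s u :=
  h.trans ⟨[x], hx⟩

theorem Reach.swap {s t : ℕ × ℕ} : Reach m n s t → Reach n m s.swap t.swap := by
  rintro ⟨w, rfl⟩
  exact ⟨w.map swapLetter, run_swap s w⟩

end Runs

/-! ### Iterates of the cycle and the transposition. -/

section Letters

variable {n : ℕ}

theorem act_a_injective (hn : 5 ≤ n) : Function.Injective (act n .a) := by
  intro p q h
  simp only [act] at h
  split_ifs at h <;> omega

theorem act_b_injective : Function.Injective (act n .b) := by
  intro p q h
  simp only [act] at h
  split_ifs at h <;> omega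

theorem iterate_act_a_lt (hn : 5 ≤ n) {p : ℕ} (hp : p < n) (k : ℕ) : (act n .a)^[k] p < n :=
  Function.Iterate.rec (fun p => p < n) hp
    (fun p hp => by simp only [act]; split_ifs <;> omega) k

theorem iterate_act_b_mem (hn : 5 ≤ n) {p : ℕ} (hp : 2 ≤ p ∧ p < n) (k : ℕ) :
    2 ≤ (act n .b)^[k] p ∧ (act n .b)^[k] p < n :=
  Function.Iterate.rec (fun p => 2 ≤ p ∧ p < n) hp
    (fun p hp => by simp only [act]; split_ifs <;> omega) k

theorem iterate_act_b_lt (hn : 5 ≤ n) {p : ℕ} (hp : p < n) (k : ℕ) : (act n .b)^[k] p < n :=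
  Function.Iterate.rec (fun p => p < n) hp
    (fun p hp => by simp only [act]; split_ifs <;> omega) k

theorem iterate_act_a_add {p : ℕ} (hp : 2 ≤ p) (k : ℕ) (hk : p + k < n) :
    (act n .a)^[k] p = p + k := by
  induction k with
  | zero => rfl
  | succ k ih =>
    rw [Function.iterate_succ_apply', ih (by omega)]
    simp only [act]
    split_ifs <;> omega

theorem exists_iterate_act_a {p t : ℕ} (hp : 2 ≤ p) (hpn : p < n) (ht : 2 ≤ t) (htn : t < n) :
    ∃ k, (act n .a)^[k] p = t := by
  -- Climb from `p` to `n - 1`, wrap around to 2, climb to `t`.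
  refine ⟨(t - 2) + (1 + (n - 1 - p)), ?_⟩
  rw [Function.iterate_add_apply, Function.iterate_add_apply,
    iterate_act_a_add hp (n - 1 - p) (by omega)]
  have h : (act n .a)^[1] (p + (n - 1 - p)) = 2 := by
    simp only [Function.iterate_one, act]
    split_ifs <;> omega
  rw [h, iterate_act_a_add le_rfl (t - 2) (by omega)]
  omega

end Letters

/-! ### Reachability of all product states. -/

section Reachability

variable {m n : ℕ}

/-- Powers of `a` place the first coordinate at `p`. Since `p` is at least 4, the transposition
fixes it, so powers of `b` can then rotate the second coordinate freely. -/
theorem reach_of_four_le (hm : 5 ≤ m) {p q : ℕ} (hp : 4 ≤ p) (hpm : p < m)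
    (hq : 2 ≤ q) (hqn : q < n) (hn : 5 ≤ n) : Reach m n (2, 2) (p, q) := by
  obtain ⟨k, hk⟩ := exists_iterate_act_a (n := m) le_rfl (by omega) (by omega) hpm
  have h₂ : 2 ≤ (act n .b)^[k] 2 ∧ (act n .b)^[k] 2 < n := iterate_act_b_mem hn (by omega) k
  obtain ⟨j, hj⟩ := exists_iterate_act_a h₂.1 h₂.2 hq hqn
  refine Reach.trans ⟨List.replicate k la, run_replicate _ _ _⟩
    ⟨List.replicate j lb, (run_replicate _ _ _).trans ?_⟩
  refine Prod.ext ?_ hj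
  change (act m .b)^[j] ((act m .a)^[k] 2) = p
  rw [hk]
  refine Function.iterate_fixed ?_ j
  simp only [act]
  split_ifs <;> omega

theorem reach_inner (hm : 5 ≤ m) (hn : 5 ≤ n) {p q : ℕ} (hp : 2 ≤ p) (hpm : p < m)
    (hq : 2 ≤ q) (hqn : q < n) : Reach m n (2, 2) (p, q) := by
  by_cases hp4 : 4 ≤ p
  · exact reach_of_four_le hm hp4 hpm hq hqn hn
  by_cases hq4 : 4 ≤ q
  · exact (reach_of_four_le hn hq4 hqn hp hpm hm).swap
  -- The remaining corner is `{2, 3} × {2, 3}`; here `a` wraps `m - 1` to 2 while transposing 2 to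
  -- 3.
  have h₂₃ : Reach m n (2, 2) (2, 3) :=
    (reach_of_four_le (p := m - 1) (q := 2) hm (by omega) (by omega) le_rfl (by omega) hn).letter la
      (by simp only [step, swapLetter, act, Prod.mk.injEq]; constructor <;> split_ifs <;> omega)
  have h₃₃ : Reach m n (2, 2) (3, 3) := (Reach.refl _).letter la
    (by simp only [step, swapLetter, act, Prod.mk.injEq]; constructor <;> split_ifs <;> omega)
  have h₃₂ : Reach m n (2, 2) (3, 2) := h₂₃.letter la
    (by simp only [step, swapLetter, act, Prod.mk.injEq]; constructor <;> split_ifs <;> omega)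
  obtain rfl | rfl : p = 2 ∨ p = 3 := by omega
  all_goals obtain rfl | rfl : q = 2 ∨ q = 3 := by omega
  exacts [Reach.refl _, h₂₃, h₃₂, h₃₃]

theorem reach_one_left (hm : 5 ≤ m) (hn : 5 ≤ n) {q : ℕ} (hq : 1 ≤ q) (hqn : q < n) :
    Reach m n (2, 2) (1, q) := by
  have inner : ∀ r, 2 ≤ r → r + 1 < n → Reach m n (2, 2) (1, r) := fun r hr hrn =>
    (reach_inner (p := m - 1) (q := r) hm hn (by omega) (by omega) hr (by omega)).letter ld
      (by simp only [step, swapLetter, act, Prod.mk.injEq]; constructor <;> split_ifs <;> omega)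
  rcases eq_or_lt_of_le hq with rfl | hq2
  · exact (reach_inner (p := m - 1) (q := n - 1) hm hn (by omega) (by omega) (by omega)
      (by omega)).letter ld
      (by simp only [step, swapLetter, act, Prod.mk.injEq]; constructor <;> split_ifs <;> omega)
  by_cases hqn' : q + 1 < n
  · exact inner q hq2 hqn'
  -- At `q = n - 1` the letter `d` would also reset the second coordinate, so this state is entered
  -- from `(1, n - 2)` by `b`, which fixes 1 on the left.
  · exact (inner (n - 2) (by omega) (by omega)).letter lb
      (by simp only [step, swapLetter, act, Prod.mk.injEq]; constructor <;> split_ifs <;> omega)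

theorem reach_of_lt (hm : 5 ≤ m) (hn : 5 ≤ n) {p q : ℕ} (hp : 1 ≤ p) (hpm : p < m)
    (hq : 1 ≤ q) (hqn : q < n) : Reach m n (2, 2) (p, q) := by
  rcases eq_or_lt_of_le hp with rfl | hp
  · exact reach_one_left hm hn hq hqn
  rcases eq_or_lt_of_le hq with rfl | hq
  · exact (reach_one_left hn hm (by omega) hpm).swap
  exact reach_inner hm hn hp hpm hq hqn

theorem reach_final_right (hm : 5 ≤ m) (hn : 5 ≤ n) {p : ℕ} (hp : 1 ≤ p) (hpm : p < m) :
    Reach m n (2, 2) (p, n) := by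
  have off : ∀ r, 1 ≤ r → r < m → r ≠ 2 → Reach m n (2, 2) (r, n) := fun r hr hrm hr2 =>
    (reach_of_lt (p := r) (q := 2) hm hn hr hrm (by omega) (by omega)).letter lf
      (by simp only [step, swapLetter, act, Prod.mk.injEq]; constructor <;> split_ifs <;> omega)
  by_cases hp2 : p = 2
  -- `f` would make a first coordinate 2 final, so `(2, n)` is entered from `(m - 1, n)` by
  -- rotation.
  · exact (off (m - 1) (by omega) (by omega) (by omega)).letter la
      (by simp only [step, swapLetter, act, Prod.mk.injEq]; constructor <;> split_ifs <;> omega)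
  · exact off p hp hpm hp2

theorem reach_all (hm : 5 ≤ m) (hn : 5 ≤ n) {p q : ℕ} (hp : 1 ≤ p) (hpm : p ≤ m)
    (hq : 1 ≤ q) (hqn : q ≤ n) : Reach m n (2, 2) (p, q) := by
  rcases eq_or_lt_of_le hpm with rfl | hpm
  · rcases eq_or_lt_of_le hqn with rfl | hqn
    · exact (Reach.refl _).letter lf
        (by simp only [step, swapLetter, act, Prod.mk.injEq]; constructor <;> split_ifs <;> omega)
    · exact (reach_final_right hn hm hq hqn).swap
  · rcases eq_or_lt_of_le hqn with rfl | hqn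
    · exact reach_final_right hm hn hp hpm
    · exact reach_of_lt hm hn hp hpm hq hqn

theorem reach_from_start (hm : 5 ≤ m) (hn : 5 ≤ n) {p q : ℕ} (hp : 1 ≤ p) (hpm : p ≤ m)
    (hq : 1 ≤ q) (hqn : q ≤ n) : Reach m n (1, 1) (p, q) :=
  ((Reach.refl (1, 1)).letter le (by
    simp only [step, swapLetter, act, Prod.mk.injEq]; constructor <;> split_ifs <;> omega)).trans
    (reach_all hm hn hp hpm hq hqn)

end Reachability

/-! ### Separating words. -/

section Separation

variable {m n : ℕ}

/-- A word mapping all nonfinal states of the first automaton to `1` and all states of the second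
one to its final state. -/
theorem exists_word_final_right (hm : 5 ≤ m) (hn : 5 ≤ n) : ∃ w, ∀ p q, q ≤ n →
    run m n (m, q) w = (m, n) ∧ (p < m → run m n (p, q) w = (1, n)) := by
  obtain ⟨u, hu⟩ := reach_all hm hn le_rfl (by omega : 1 ≤ m) (by omega : 1 ≤ n) le_rfl
  have hsnd : ∀ p q, q ≤ n → (run m n (p, q) (le :: u)).2 = n := by
    intro p q hq
    rw [run_cons]
    rcases eq_or_lt_of_le hq with rfl | hq
    · rw [step, act_final hn]
      exact run_snd_final hn _ u
    · rw [run_snd_congr (t := (2, 2)) (by simp [step, swapLetter, act, hq]), hu]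
  refine ⟨le :: u, fun p q hq => ⟨Prod.ext (run_fst_final hm _ _) (hsnd _ _ hq), fun hp =>
    Prod.ext ?_ (hsnd _ _ hq)⟩⟩
  rw [run_cons, run_fst_congr (t := (2, 2)) (by simp [step, act, hp]), hu]

/-- Rotate `p` to 2 with `a` and apply `f`. Injectivity keeps `p'` away from 2, and `q'`, fixed by
the transposition and different from 2, is unaffected. -/
theorem exists_word_fst_of_fixed (hm : 5 ≤ m) {p p' q' : ℕ} (q : ℕ) (hp : 2 ≤ p)
    (hpm : p < m) (hpm' : p' < m) (hne : p ≠ p') (hq' : act n .b q' = q') (hq2 : q' ≠ 2) :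
    ∃ w, (run m n (p, q) w).1 = m ∧ (run m n (p', q') w).1 < m ∧ (run m n (p', q') w).2 = q' := by
  obtain ⟨k, hk⟩ := exists_iterate_act_a (n := m) hp hpm le_rfl (by omega)
  have hne' : (act m .a)^[k] p' ≠ 2 := fun h =>
    hne ((act_a_injective hm).iterate k (hk.trans h.symm))
  have hlt := iterate_act_a_lt hm hpm' k
  refine ⟨List.replicate k la ++ [lf], ?_, ?_, ?_⟩
  · rw [run_append, run_replicate]
    simp [run, step, act, hk]
  · rw [run_append, run_replicate]
    simpa [run, step, act, hne'] using hlt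
  · rw [run_append, run_replicate]
    have : (act n .b)^[k] q' = q' := Function.iterate_fixed hq' k
    simp [run, step, swapLetter, act, hq2, this]

theorem exists_word_fst (hm : 5 ≤ m) (hn : 5 ≤ n) {p p' q' : ℕ} (q : ℕ) (hp : 2 ≤ p)
    (hpm : p < m) (hpm' : p' < m) (hne : p ≠ p') (hqn : q' ≤ n) :
    ∃ w, (run m n (p, q) w).1 = m ∧ (run m n (p', q') w).1 < m ∧
      (q' < n → (run m n (p', q') w).2 < n) := by
  by_cases hq : 2 ≤ q' ∧ q' < n
  -- Park `q'` at 4, which the transposition fixes. The first coordinates are only permuted by `b`,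
  -- so they stay distinct and the larger range condition on `p` survives.
  · obtain ⟨j, hj⟩ := exists_iterate_act_a hq.1 hq.2 (by omega : 2 ≤ 4) (by omega : 4 < n)
    have hP := iterate_act_b_mem hm ⟨hp, hpm⟩ j
    obtain ⟨w, h₁, h₂, h₃⟩ := exists_word_fst_of_fixed (n := n) (q' := 4) hm
      ((act n .a)^[j] q) hP.1 hP.2 (iterate_act_b_lt hm hpm' j)
      ((act_b_injective.iterate j).ne hne) (by simp [act]) (by omega)
    refine ⟨List.replicate j lb ++ w, ?_⟩
    rw [run_append, run_append, run_replicate, run_replicate]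
    simp only [swapLetter, hj]
    exact ⟨h₁, h₂, fun _ => by omega⟩
  · obtain ⟨w, h₁, h₂, h₃⟩ := exists_word_fst_of_fixed (n := n) (q' := q') hm q hp hpm hpm' hne
      (by simp only [act]; split_ifs <;> omega) (by omega)
    exact ⟨w, h₁, h₂, fun _ => by omega⟩

end Separation

/-! ### Quotients as futures of product states. -/

section Quotients

/-- The words leading from the state `s` of the product automaton to a state satisfying `P`. -/
def future (m n : ℕ) (P : ℕ × ℕ → Prop) (s : ℕ × ℕ) : Language SubLetter :=
  {w | P (run m n s w)}

variable {m n : ℕ} {P : ℕ × ℕ → Prop}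

theorem future_run {s t : ℕ × ℕ} (h : future m n P s = future m n P t) (w : List SubLetter) :
    future m n P (run m n s w) = future m n P (run m n t w) := by
  ext v
  change P _ ↔ P _
  rw [← run_append, ← run_append]
  exact Set.ext_iff.mp h (w ++ v)

theorem future_iff {s t : ℕ × ℕ} (h : future m n P s = future m n P t) (w : List SubLetter) :
    P (run m n s w) ↔ P (run m n t w) :=
  Set.ext_iff.mp h w

theorem run_mem (hm : 5 ≤ m) (hn : 5 ≤ n) {s : ℕ × ℕ} (hs : s ∈ Set.Icc 1 m ×ˢ Set.Icc 1 n)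
    (w : List SubLetter) : run m n s w ∈ Set.Icc 1 m ×ˢ Set.Icc 1 n := by
  induction w generalizing s with
  | nil => exact hs
  | cons x w ih => exact ih ⟨act_mem hm _ _ hs.1, act_mem hn _ _ hs.2⟩

theorem range_leftQuotient_future (hm : 5 ≤ m) (hn : 5 ≤ n) :
    Set.range (future m n P (1, 1)).leftQuotient =
      future m n P '' (Set.Icc 1 m ×ˢ Set.Icc 1 n) := by
  have key : ∀ w, (future m n P (1, 1)).leftQuotient w = future m n P (run m n (1, 1) w) := by
    intro w
    ext v
    change P _ ↔ P _
    rw [run_append]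
  ext K
  constructor
  · rintro ⟨w, rfl⟩
    exact ⟨_, run_mem hm hn ⟨⟨le_rfl, by omega⟩, ⟨le_rfl, by omega⟩⟩ w, (key w).symm⟩
  · rintro ⟨⟨p, q⟩, ⟨⟨hp, hpm⟩, hq, hqn⟩, rfl⟩
    obtain ⟨w, hw⟩ := reach_from_start hm hn hp hpm hq hqn
    exact ⟨w, by rw [key, hw]⟩

/-- When the partial map of letters has a total inverse `ι`, each word has exactly one preimage. -/
theorem dialect_eq {α β : Type*} {π : α → Option β} {ι : β → α}
    (h : ∀ x y, π x = some y ↔ x = ι y) (L : Language α) :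
    dialect π L = {w | w.map ι ∈ L} := by
  have key : ∀ (v : List α) (w : List β), v.map π = w.map some ↔ v = w.map ι := by
    intro v
    induction v with
    | nil => intro w; cases w <;> simp
    | cons x v ih => intro w; cases w <;> simp [ih, h]
  ext w
  change (∃ v ∈ L, v.map π = w.map some) ↔ w.map ι ∈ L
  simp [key]

theorem mem_witness (hn : 5 ≤ n) (w : List Letter) :
    w ∈ witness n hn ↔ w.foldl (fun p x => act n x p) 1 = n := by
  have key : ∀ q : State n, ((witnessDFA n hn).evalFrom q w).1 =
      w.foldl (fun p x => act n x p) q.1 := by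
    induction w with
    | nil => intro q; rfl
    | cons x w ih => intro q; exact ih _
  change ((witnessDFA n hn).evalFrom _ w).1 = n ↔ _
  rw [key]
  rfl

theorem mem_witnessAB (hm : 5 ≤ m) (w : List SubLetter) :
    w ∈ witnessAB m hm ↔ (run m n (1, 1) w).1 = m := by
  rw [witnessAB, dialect_eq (ι := Subtype.val)]
  · exact (mem_witness hm _).trans (by rw [run_fst])
  · rintro x ⟨y, hy⟩
    cases x <;> cases y <;> first | exact absurd rfl hy | simp [permAB]

theorem mem_witnessBA (hn : 5 ≤ n) (w : List SubLetter) :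
    w ∈ witnessBA n hn ↔ (run m n (1, 1) w).2 = n := by
  rw [witnessBA, dialect_eq (ι := fun y => (swapLetter y).1)]
  · exact (mem_witness hn _).trans (by rw [run_snd])
  · rintro x ⟨y, hy⟩
    cases x <;> cases y <;> first | exact absurd rfl hy | simp [permBA, swapLetter]

end Quotients

/-! ### Counting distinct futures. -/

section Separated

variable {m n : ℕ} {P : ℕ × ℕ → Prop}

theorem fst_eq_of_future_eq (hm : 5 ≤ m) (hn : 5 ≤ n) (hP : ¬(P (1, n) ↔ P (m, n)))
    {s t : ℕ × ℕ} (hs : s ∈ Set.Icc 1 m ×ˢ Set.Icc 1 n) (ht : t ∈ Set.Icc 1 m ×ˢ Set.Icc 1 n)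
    (h : future m n P s = future m n P t) : s.1 = t.1 := by
  obtain ⟨u, hu⟩ := exists_word_final_right hm hn
  have final : ∀ {s t : ℕ × ℕ}, s ∈ Set.Icc 1 m ×ˢ Set.Icc 1 n →
      t ∈ Set.Icc 1 m ×ˢ Set.Icc 1 n → future m n P s = future m n P t →
      s.1 = m → ¬ t.1 < m := by
    rintro ⟨p, q⟩ ⟨p', q'⟩ hs ht h hp hp'
    obtain rfl : p = m := hp
    have := future_iff h u
    rw [(hu p q hs.2.2).1, (hu p' q' ht.2.2).2 hp'] at this
    exact hP this.symm
  -- Assuming `p' < p` puts `p` at 2 or above, hence on the cycle unless it is final.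
  have main : ∀ {s t : ℕ × ℕ}, s ∈ Set.Icc 1 m ×ˢ Set.Icc 1 n →
      t ∈ Set.Icc 1 m ×ˢ Set.Icc 1 n → future m n P s = future m n P t → ¬ t.1 < s.1 := by
    rintro ⟨p, q⟩ ⟨p', q'⟩ hs ht h hlt
    have hp' : 1 ≤ p' := ht.1.1
    rcases eq_or_lt_of_le hs.1.2 with hp | hp
    · exact final hs ht h hp (lt_of_lt_of_eq hlt hp)
    · obtain ⟨w, h₁, h₂, -⟩ := exists_word_fst (p := p) (p' := p') (q' := q') hm hn q
        (by simp only at hlt; omega) hp (lt_trans hlt hp) (ne_of_gt hlt) ht.2.2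
      exact final (run_mem hm hn hs w) (run_mem hm hn ht w) (future_run h w) h₁ h₂
  exact le_antisymm (not_lt.mp (main hs ht h)) (not_lt.mp (main ht hs h.symm))

theorem future_swap (s : ℕ × ℕ) (w : List SubLetter) :
    w.map swapLetter ∈ future m n P s.swap ↔ w ∈ future n m (fun t => P t.swap) s := by
  change P _ ↔ P _
  rw [run_swap]

theorem future_swap_eq {s t : ℕ × ℕ} (h : future m n P s = future m n P t) :
    future n m (fun t => P t.swap) s.swap = future n m (fun t => P t.swap) t.swap := by
  ext w
  rw [← future_swap, ← future_swap, Prod.swap_swap, Prod.swap_swap, h]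

theorem snd_eq_of_future_eq (hm : 5 ≤ m) (hn : 5 ≤ n) (hP : ¬(P (m, 1) ↔ P (m, n)))
    {s t : ℕ × ℕ} (hs : s ∈ Set.Icc 1 m ×ˢ Set.Icc 1 n) (ht : t ∈ Set.Icc 1 m ×ˢ Set.Icc 1 n)
    (h : future m n P s = future m n P t) : s.2 = t.2 :=
  fst_eq_of_future_eq (s := s.swap) (t := t.swap) hn hm hP ⟨hs.2, hs.1⟩ ⟨ht.2, ht.1⟩
    (future_swap_eq h)

theorem complexity_future_eq_mul (hm : 5 ≤ m) (hn : 5 ≤ n) (hP : ¬(P (1, n) ↔ P (m, n)))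
    (hP' : ¬(P (m, 1) ↔ P (m, n))) : complexity (future m n P (1, 1)) = m * n := by
  rw [complexity, range_leftQuotient_future hm hn, Set.InjOn.ncard_image, Set.ncard_prod]
  · simp [Set.ncard_eq_toFinset_card']
  · exact fun s hs t ht h => Prod.ext (fst_eq_of_future_eq hm hn hP hs ht h)
      (snd_eq_of_future_eq hm hn hP' hs ht h)

/-- Here `(1, n)` and `(m, n)` are both rejecting, so first coordinates are compared only after the
second ones are known to agree; a common nonfinal second coordinate is kept nonfinal by the
separating word. -/
theorem complexity_future_diff (hm : 5 ≤ m) (hn : 5 ≤ n) :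
    complexity (future m n (fun s => s.1 = m ∧ s.2 ≠ n) (1, 1)) = m * n - (m - 1) := by
  have him : future m n (fun s => s.1 = m ∧ s.2 ≠ n) '' (Set.Icc 1 m ×ˢ Set.Icc 1 n) =
      future m n (fun s => s.1 = m ∧ s.2 ≠ n) ''
        insert (1, n) (Set.Icc 1 m ×ˢ Set.Icc 1 (n - 1)) := by
    have hempty : ∀ p, future m n (fun s => s.1 = m ∧ s.2 ≠ n) (p, n) = (∅ : Set _) := by
      intro p
      ext w
      exact iff_of_false (fun h => h.2 (run_snd_final hn p w)) id
    apply subset_antisymm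
    · rintro _ ⟨⟨p, q⟩, ⟨hp, hq⟩, rfl⟩
      rcases eq_or_lt_of_le hq.2 with rfl | hlt
      · exact ⟨_, Set.mem_insert _ _, (hempty 1).trans (hempty p).symm⟩
      · exact ⟨(p, q), Or.inr ⟨hp, hq.1, Nat.le_sub_one_of_lt hlt⟩, rfl⟩
    · refine Set.image_mono (Set.insert_subset ⟨⟨le_rfl, by omega⟩, by omega, le_rfl⟩ ?_)
      exact Set.prod_mono subset_rfl (Set.Icc_subset_Icc_right (by omega))
  rw [complexity, range_leftQuotient_future hm hn, him, Set.InjOn.ncard_image,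
    Set.ncard_insert_of_notMem _ ((Set.finite_Icc _ _).prod (Set.finite_Icc _ _)), Set.ncard_prod]
  · simp only [Set.ncard_eq_toFinset_card', Set.toFinset_Icc, Nat.card_Icc, Nat.add_sub_cancel]
    obtain ⟨n, rfl⟩ : ∃ k, n = k + 1 := ⟨n - 1, by omega⟩
    rw [Nat.add_sub_cancel, Nat.mul_succ]
    omega
  · rintro ⟨-, h⟩
    have : n ≤ n - 1 := h.2
    omega
  · have hsub : insert (1, n) (Set.Icc 1 m ×ˢ Set.Icc 1 (n - 1)) ⊆
        Set.Icc 1 m ×ˢ Set.Icc 1 n :=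
      Set.insert_subset ⟨⟨le_rfl, by omega⟩, by omega, le_rfl⟩
        (Set.prod_mono subset_rfl (Set.Icc_subset_Icc_right (by omega)))
    have main : ∀ {p p' q : ℕ}, (p, q) ∈ Set.Icc 1 m ×ˢ Set.Icc 1 n →
        (p', q) ∈ Set.Icc 1 m ×ˢ Set.Icc 1 n → q < n →
        future m n (fun s => s.1 = m ∧ s.2 ≠ n) (p, q) =
          future m n (fun s => s.1 = m ∧ s.2 ≠ n) (p', q) → ¬ p' < p := by
      intro p p' q hs ht hq h hlt
      have hp' : 1 ≤ p' := ht.1.1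
      rcases eq_or_lt_of_le hs.1.2 with hp | hp
      -- The empty word already separates: `(m, q)` is accepting and `(p', q)` is not.
      · have := (future_iff h []).mp ⟨hp, hq.ne⟩
        simp only [run_nil] at this hp
        omega
      · obtain ⟨w, h₁, h₂, h₃⟩ := exists_word_fst (p := p) (p' := p') (q' := q) hm hn q
          (by omega) hp (lt_trans hlt hp) (ne_of_gt hlt) ht.2.2
        have h₄ : (run m n (p, q) w).2 = (run m n (p', q) w).2 :=
          run_snd_congr (s := (p, q)) (t := (p', q)) rfl w
        exact h₂.ne ((future_iff h w).mp ⟨h₁, h₄ ▸ (h₃ hq).ne⟩).1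
    rintro ⟨p, q⟩ hs ⟨p', q'⟩ ht h
    have hq : q = q' := snd_eq_of_future_eq hm hn (by simp; omega) (hsub hs) (hsub ht) h
    subst hq
    by_cases hqn : q = n
    · have one : ∀ p, (p, q) ∈ insert (1, n) (Set.Icc 1 m ×ˢ Set.Icc 1 (n - 1)) → p = 1 := by
        rintro p (hp | hp)
        · exact congrArg Prod.fst hp
        · have : q ≤ n - 1 := hp.2.2
          omega
      rw [one p hs, one p' ht]
    · have hlt : q < n := lt_of_le_of_ne (hsub hs).2.2 hqn
      rw [le_antisymm (not_lt.mp (main (hsub hs) (hsub ht) hlt h))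
        (not_lt.mp (main (hsub ht) (hsub hs) hlt h.symm))]

/-- The word from `exists_word_fst` makes the first state accepting while leaving both coordinates
of the other nonfinal. -/
theorem fst_eq_of_future_union_eq (hm : 5 ≤ m) (hn : 5 ≤ n) {s t : ℕ × ℕ}
    (hs : s ∈ Set.Icc 1 (m - 1) ×ˢ Set.Icc 1 (n - 1))
    (ht : t ∈ Set.Icc 1 (m - 1) ×ˢ Set.Icc 1 (n - 1))
    (h : future m n (fun s => s.1 = m ∨ s.2 = n) s = future m n (fun s => s.1 = m ∨ s.2 = n) t) :
    s.1 = t.1 := by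
  have main : ∀ {s t : ℕ × ℕ}, s ∈ Set.Icc 1 (m - 1) ×ˢ Set.Icc 1 (n - 1) →
      t ∈ Set.Icc 1 (m - 1) ×ˢ Set.Icc 1 (n - 1) →
      future m n (fun s => s.1 = m ∨ s.2 = n) s = future m n (fun s => s.1 = m ∨ s.2 = n) t →
      ¬ t.1 < s.1 := by
    rintro ⟨p, q⟩ ⟨p', q'⟩ ⟨⟨hp, hpm⟩, hq, hqn⟩ ⟨⟨hp', hpm'⟩, hq', hqn'⟩ h hlt
    simp only at hp hpm hq hqn hp' hpm' hq' hqn' hlt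
    obtain ⟨w, h₁, h₂, h₃⟩ := exists_word_fst (p := p) (p' := p') (q' := q') hm hn q
      (by omega) (by omega) (by omega) (ne_of_gt hlt) (by omega)
    rcases (future_iff h w).mp (Or.inl h₁) with h₄ | h₄
    · exact h₂.ne h₄
    · exact (h₃ (by omega)).ne h₄
  exact le_antisymm (not_lt.mp (main hs ht h)) (not_lt.mp (main ht hs h.symm))

theorem complexity_future_union (hm : 5 ≤ m) (hn : 5 ≤ n) :
    complexity (future m n (fun s => s.1 = m ∨ s.2 = n) (1, 1)) = m * n - (m + n - 2) := by
  have huniv : ∀ s : ℕ × ℕ, s.1 = m ∨ s.2 = n →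
      future m n (fun s => s.1 = m ∨ s.2 = n) s = (Set.univ : Set _) := by
    rintro ⟨p, q⟩ hs
    ext w
    refine iff_of_true ?_ trivial
    rcases hs with rfl | rfl
    · exact Or.inl (run_fst_final hm q w)
    · exact Or.inr (run_snd_final hn p w)
  have him : future m n (fun s => s.1 = m ∨ s.2 = n) '' (Set.Icc 1 m ×ˢ Set.Icc 1 n) =
      future m n (fun s => s.1 = m ∨ s.2 = n) ''
        insert (m, n) (Set.Icc 1 (m - 1) ×ˢ Set.Icc 1 (n - 1)) := by
    apply subset_antisymm
    · rintro _ ⟨⟨p, q⟩, ⟨hp, hq⟩, rfl⟩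
      by_cases hs : p = m ∨ q = n
      · exact ⟨_, Set.mem_insert _ _, (huniv (m, n) (Or.inl rfl)).trans (huniv (p, q) hs).symm⟩
      · have h₁ : p ≤ m := hp.2
        have h₂ : q ≤ n := hq.2
        exact ⟨(p, q), Or.inr ⟨⟨hp.1, by simp only; omega⟩, hq.1, by simp only; omega⟩, rfl⟩
    · refine Set.image_mono (Set.insert_subset ⟨⟨by omega, le_rfl⟩, by omega, le_rfl⟩ ?_)
      exact Set.prod_mono (Set.Icc_subset_Icc_right (by omega))
        (Set.Icc_subset_Icc_right (by omega))
  have hnot : ∀ s ∈ Set.Icc 1 (m - 1) ×ˢ Set.Icc 1 (n - 1), ¬(s.1 = m ∨ s.2 = n) := by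
    rintro ⟨p, q⟩ ⟨⟨hp, hpm⟩, hq, hqn⟩
    simp only at hp hpm hq hqn ⊢
    omega
  rw [complexity, range_leftQuotient_future hm hn, him, Set.InjOn.ncard_image,
    Set.ncard_insert_of_notMem _ ((Set.finite_Icc _ _).prod (Set.finite_Icc _ _)), Set.ncard_prod]
  · simp only [Set.ncard_eq_toFinset_card', Set.toFinset_Icc, Nat.card_Icc, Nat.add_sub_cancel]
    obtain ⟨m, rfl⟩ : ∃ k, m = k + 1 := ⟨m - 1, by omega⟩
    obtain ⟨n, rfl⟩ : ∃ k, n = k + 1 := ⟨n - 1, by omega⟩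
    rw [Nat.add_sub_cancel, Nat.add_sub_cancel, Nat.mul_succ, Nat.succ_mul]
    omega
  · exact fun h => hnot _ h (Or.inl rfl)
  · have hfinal : ∀ s ∈ Set.Icc 1 (m - 1) ×ˢ Set.Icc 1 (n - 1),
        future m n (fun s => s.1 = m ∨ s.2 = n) (m, n) ≠
          future m n (fun s => s.1 = m ∨ s.2 = n) s :=
      fun s hs h => hnot s hs ((future_iff h []).mp (Or.inl rfl))
    rintro s (rfl | hs) t (rfl | ht) h
    · rfl
    · exact absurd h (hfinal t ht)
    · exact absurd h.symm (hfinal s hs)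
    · refine Prod.ext (fst_eq_of_future_union_eq hm hn hs ht h) ?_
      -- Union is symmetric, so second coordinates follow by reflecting the product.
      refine fst_eq_of_future_union_eq (s := s.swap) (t := t.swap) hn hm ⟨hs.2, hs.1⟩
        ⟨ht.2, ht.1⟩ ?_
      simpa only [Prod.fst_swap, Prod.snd_swap, or_comm] using future_swap_eq h

end Separated

end TwoSidedIdeals

open TwoSidedIdeals in
theorem mainTheorem4 (m n : ℕ) (hm : 5 ≤ m) (hn : 5 ≤ n) :
    complexity (witnessAB m hm ⊓ witnessBA n hn) = m * n ∧
    complexity (symmDiff (witnessAB m hm) (witnessBA n hn)) = m * n ∧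
    complexity (witnessAB m hm \ witnessBA n hn) = m * n - (m - 1) ∧
    complexity (witnessAB m hm ⊔ witnessBA n hn) = m * n - (m + n - 2) := by
  have hA : ∀ w, w ∈ witnessAB m hm ↔ (run m n (1, 1) w).1 = m := mem_witnessAB hm
  have hB : ∀ w, w ∈ witnessBA n hn ↔ (run m n (1, 1) w).2 = n := mem_witnessBA hn
  refine ⟨?_, ?_, ?_, ?_⟩
  · rw [← complexity_future_eq_mul (P := fun s => s.1 = m ∧ s.2 = n) hm hn
      (by simp; omega) (by simp; omega)]
    congr 1
    ext w
    exact and_congr (hA w) (hB w)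
  · rw [← complexity_future_eq_mul
      (P := fun s => (s.1 = m ∧ s.2 ≠ n) ∨ (s.2 = n ∧ s.1 ≠ m)) hm hn
      (by simp; omega) (by simp; omega)]
    congr 1
    ext w
    exact or_congr (and_congr (hA w) (not_congr (hB w))) (and_congr (hB w) (not_congr (hA w)))
  · rw [← complexity_future_diff hm hn]
    congr 1
    ext w
    exact and_congr (hA w) (not_congr (hB w))
  · rw [← complexity_future_union hm hn]
    congr 1
    ext w
    exact or_congr (hA w) (hB w)
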